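/- Let $V$ be a complex Banach space. A spectral measure is a map $E$ from the Borel sets of $\mathbb{C}$ to the bounded operators on $V$ with $E(\emptyset)=0$, $E(\mathbb{C})=I$, $E(\sigma\cap\tau)=E(\sigma)E(\tau)$, $\sup_\sigma\|E(\sigma)\|<\infty$, which is countably additive in the strong operator topology. A bounded operator $X$ on $V$ is a (Dunford) spectral operator with spectral measure $E_X$ if $E_X$ is a spectral measure such that, for every Borel set $\sigma$, $E_X(\sigma)$ commutes with $X$ and $\sigma\left(X|_{E_X(\sigma)V}\right)\subseteq\overline{\sigma}$. For an operator-valued function $f$, $\int_{D} f(\lambda)\,dE(\lambda)$ denotes the limit in operator norm, along refinement of finite partitions of $D$ into nonempty Borel sets $\sigma_k$, of the sums $\sum_k f(\xi_k)E(\sigma_k)$ with arbitrary $\xi_k\in\sigma_k$; for a scalar function $g$ put $f=gI$. An operator $S$ is of scalar type if it is a spectral operator with some spectral measure $E$ such that $S=\int_{\sigma(S)}\lambda\,dE(\lambda)$, and $N$ is generalized nilpotent if $\|N^n\|^{1/n}\to 0$. Let $X$ be a spectral operator with spectral measure $E_X$, and let $\sigma(X)$ be its spectrum. Then both integrals below exist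 and $$X=\int_{\sigma(X)}\lambda\,dE_X(\lambda)+\int_{\sigma(X)}(X-\lambda I)\,dE_X(\lambda).$$ Moreover, the second integral is the nilpotent (radical) part of $X$: the first integral $S_X$ is of scalar type, the second integral $N_X$ is generalized nilpotent, $S_XN_X=N_XS_X$, and $(S_X,N_X)$ is the only pair of bounded operators $(S,N)$ with $X=S+N$, $S$ of scalar type, $N$ generalized nilpotent and $SN=NS$. -/

import Mathlib

open Filter Topology

noncomputable section

/-- A spectral measure on the Borel sets of the complex plane with values in the bounded
projections of a complex Banach space `V`: a bounded homomorphism from the Boolean algebra of Borel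
sets to a Boolean algebra of projections, countably additive in the strong operator topology.
Only the values of `E` at Borel sets matter. (`E s * E s = E s` is the case `t = s` of `inter`;
finite additivity is part of `hasSum_iUnion`.) -/
structure IsSpectralMeasure {V : Type*} [NormedAddCommGroup V] [NormedSpace ℂ V]
    (E : Set ℂ → V →L[ℂ] V) : Prop where
  empty : E ∅ = 0
  univ : E Set.univ = 1
  inter : ∀ s t : Set ℂ, MeasurableSet s → MeasurableSet t → E (s ∩ t) = E s * E t
  hasSum_iUnion : ∀ s : ℕ → Set ℂ, (∀ n, MeasurableSet (s n)) →
    Pairwise (fun m n => Disjoint (s m) (s n)) → ∀ x : V, HasSum (fun n => E (s n) x) (E (⋃ n, s n) x)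
  bounded : ∃ K : ℝ, ∀ s : Set ℂ, MeasurableSet s → ‖E s‖ ≤ K

/-- The restriction `X | P V` of a bounded operator `X` to the range of an operator `P` that commutes
with it, as a bounded operator on that range. -/
def restrictRange {V : Type*} [NormedAddCommGroup V] [NormedSpace ℂ V]
    (X P : V →L[ℂ] V) (h : Commute X P) :
    (LinearMap.range (P : V →ₗ[ℂ] V)) →L[ℂ] (LinearMap.range (P : V →ₗ[ℂ] V)) :=
  X.restrict (by
    rintro _ ⟨y, rfl⟩
    exact ⟨X y, (DFunLike.congr_fun h.eq y).symm⟩)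

/-- `E` is a spectral measure of the operator `X` (a resolution of the identity for `X`): it commutes
with `X`, and for every Borel set `s` the spectrum of the restriction of `X` to the range of `E s`
lies in the closure of `s`. -/
structure IsResolutionOfIdentity {V : Type*} [NormedAddCommGroup V] [NormedSpace ℂ V]
    (X : V →L[ℂ] V) (E : Set ℂ → V →L[ℂ] V) : Prop where
  isSpectralMeasure : IsSpectralMeasure E
  commute : ∀ s : Set ℂ, MeasurableSet s → Commute X (E s)
  spectrum_subset : ∀ (s : Set ℂ) (hs : MeasurableSet s),
    spectrum ℂ (restrictRange X (E s) (commute s hs)) ⊆ closure s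

/-- `∫_{λ ∈ D} f(λ) dE(λ) = A` for an operator-valued `f`: the Riemann sums `∑ f(ξ_s) E(s)` over the
finite partitions of `D` into nonempty Borel sets `s`, with arbitrary tags `ξ_s ∈ s`, converge to `A`
in operator norm along refinement of partitions. For a scalar function `g`, the integral
`∫ g(λ) dE(λ)` is that of `f(λ) = g(λ) I`. In `Finpartition`, `P ≤ P₀` says that `P` refines `P₀`. -/
def HasSpectralIntegral {V : Type*} [NormedAddCommGroup V] [NormedSpace ℂ V]
    (E : Set ℂ → V →L[ℂ] V) (D : Set ℂ) (f : ℂ → V →L[ℂ] V) (A : V →L[ℂ] V) : Prop :=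
  ∀ ε : ℝ, 0 < ε → ∃ P₀ : Finpartition D, (∀ s ∈ P₀.parts, MeasurableSet s) ∧
    ∀ P : Finpartition D, P ≤ P₀ → (∀ s ∈ P.parts, MeasurableSet s) →
      ∀ ξ : Set ℂ → ℂ, (∀ s ∈ P.parts, ξ s ∈ s) →
        ‖∑ s ∈ P.parts, f (ξ s) * E s - A‖ < ε

/-- An operator of scalar type: it has a spectral measure `E` with `S = ∫_{σ(S)} λ dE(λ)`. -/
def IsScalarType {V : Type*} [NormedAddCommGroup V] [NormedSpace ℂ V] (S : V →L[ℂ] V) : Prop :=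
  ∃ E : Set ℂ → V →L[ℂ] V, IsResolutionOfIdentity S E ∧
    HasSpectralIntegral E (spectrum ℂ S) (fun z => z • (1 : V →L[ℂ] V)) S

/-- Generalized nilpotent (quasinilpotent) operators: `‖N ^ n‖ ^ (1 / n) → 0`. -/
def IsGeneralizedNilpotent {V : Type*} [NormedAddCommGroup V] [NormedSpace ℂ V]
    (N : V →L[ℂ] V) : Prop :=
  Tendsto (fun n : ℕ => ‖N ^ n‖ ^ (1 / (n : ℝ))) atTop (𝓝 0)

/-- `X = S + N` is a canonical decomposition of `X`, with scalar part `S` and (generalized) nilpotent,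
or radical, part `N`. -/
structure IsCanonicalDecomposition {V : Type*} [NormedAddCommGroup V] [NormedSpace ℂ V]
    (X S N : V →L[ℂ] V) : Prop where
  eq_add : X = S + N
  isScalarType : IsScalarType S
  isGeneralizedNilpotent : IsGeneralizedNilpotent N
  commute : Commute S N

end

/-!
The argument measures spectra by exponential growth: in a Banach algebra the spectrum of `a` lies in
the disc of radius `r` about `0` iff `‖a ^ n‖ = O(ρ ^ n)` for every `ρ > r`. Such bounds add up for
commuting elements and pass between an operator and its restrictions to ranges of projections.

*Existence.* For disjoint Borel sets `A i` one has `‖∑ c i • E (A i)‖ ≤ 4 K sup |c i|`, where `K`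
bounds `E` (`IsSpectralMeasure.norm_sum_smul_le`). Hence the Riemann sums of `∫ λ dE(λ)` over the
compact set `σ(X)` are Cauchy and `S` exists. Since `E (σ(X)) = 1`, the Riemann sums of the second
integral are `X` minus those of the first, so it is `N = X - S`. On the range of `E s`, for `s` of
diameter at most `ε` around `ξ`, the operator `X - ξ` has growth rate at most `2 ε` because its
spectrum is small, and `S - ξ` has norm at most `4 K ε`. Thus `N` has growth rate `O(ε)` on each of
finitely many such ranges, which together span the space: `N` is quasinilpotent
(`IsResolutionOfIdentity.isGeneralizedNilpotent_sub`). A commuting quasinilpotent perturbation changes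
neither the spectrum of an operator nor that of its restrictions (`spectrum_add_eq`), so `E` is a
resolution of the identity for `S` and `σ(S) = σ(X)`; therefore `S` is of scalar type.

*Uniqueness.* The key fact is that an operator `A` commuting with `X` intertwines any two resolutions
of the identity `E`, `E'` of `X` (`IsResolutionOfIdentity.mul_eq_mul_of_commute`). If `s` lies in a
disc around `η` and `t` outside a larger one, then
`E s * A * E' t = (X - η) ^ n * E s * A * R n`, where `R n` inverts `(X - η) ^ n` on the range of
`E' t`; the right-hand side tends to `0`. By the Lindelöf property `E tᶜ * A * E' t = 0` for closed
`t`, and symmetrically `E t * A * E' tᶜ = 0`, whence `E t * A = A * E' t`, first for closed and then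
for all Borel sets. Given another decomposition `X = S' + N'` with a resolution `E'` of `S'`, the
operator `N'` commutes with `E'`, so `E'` is a resolution of `X` by the perturbation lemma. Taking
`A = 1` gives `E = E'` on Borel sets, and `S' = S` because both are the same integral.
-/

/-! ### Exponential growth of powers in a Banach algebra -/

/-- The sequence `u` grows at most like `ρ ^ n`. For `u n = a ^ n` this is a bound for the spectral
radius of `a` that survives restriction to, and extension from, the range of a projection. -/
def HasGrowth {A : Type*} [NormedRing A] (u : ℕ → A) (ρ : ℝ) : Prop :=
  ∃ C : ℝ, 0 ≤ C ∧ ∀ n, ‖u n‖ ≤ C * ρ ^ n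

theorem HasGrowth.of_eventually {A : Type*} [NormedRing A] {u : ℕ → A} {ρ : ℝ} (hρ : 0 < ρ)
    (h : ∀ᶠ n in atTop, ‖u n‖ ≤ ρ ^ n) : HasGrowth u ρ := by
  obtain ⟨N, hN⟩ := eventually_atTop.1 h
  have hterm : ∀ k, 0 ≤ ‖u k‖ / ρ ^ k := fun k => by positivity
  refine ⟨1 + ∑ k ∈ Finset.range N, ‖u k‖ / ρ ^ k,
    add_nonneg zero_le_one (Finset.sum_nonneg fun k _ => hterm k), fun n => ?_⟩
  have hpow : 0 < ρ ^ n := pow_pos hρ n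
  rcases le_or_gt N n with hn | hn
  · refine (hN n hn).trans (le_mul_of_one_le_left hpow.le ?_)
    exact le_add_of_nonneg_right (Finset.sum_nonneg fun k _ => hterm k)
  · rw [← div_le_iff₀ hpow]
    refine le_add_of_nonneg_of_le zero_le_one ?_
    exact Finset.single_le_sum (f := fun k => ‖u k‖ / ρ ^ k) (fun k _ => hterm k)
      (Finset.mem_range.2 hn)

/-- One half of the spectral radius formula: powers grow at most like `ρ ^ n` when the spectrum lies
in a disc of radius smaller than `ρ`. -/
theorem hasGrowth_pow_of_spectrum_subset {A : Type*} [NormedRing A] [NormedAlgebra ℂ A]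
    [CompleteSpace A] {a : A} {r ρ : ℝ} (hρ : 0 < ρ) (hr : r < ρ)
    (h : spectrum ℂ a ⊆ Metric.closedBall 0 r) : HasGrowth (fun n => a ^ n) ρ := by
  refine HasGrowth.of_eventually hρ ?_
  have hlt : spectralRadius ℂ a < ENNReal.ofReal ρ := by
    refine lt_of_le_of_lt (b := ENNReal.ofReal r) ?_ ((ENNReal.ofReal_lt_ofReal_iff hρ).2 hr)
    refine iSup₂_le fun k hk => ?_
    have hk' : ‖k‖ ≤ r := by simpa using h hk
    change ‖k‖ₑ ≤ _
    rw [← ofReal_norm]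
    exact ENNReal.ofReal_le_ofReal hk'
  have hev := (spectrum.pow_norm_pow_one_div_tendsto_nhds_spectralRadius a).eventually_lt_const hlt
  filter_upwards [hev, eventually_gt_atTop 0] with n hn hn0
  have h1 : ‖a ^ n‖ ^ (1 / n : ℝ) < ρ := (ENNReal.ofReal_lt_ofReal_iff hρ).1 hn
  have h2 := pow_le_pow_left₀ (Real.rpow_nonneg (norm_nonneg _) _) h1.le n
  rwa [one_div, Real.rpow_inv_natCast_pow (norm_nonneg _) hn0.ne'] at h2

theorem HasGrowth.mono {A : Type*} [NormedRing A] {u : ℕ → A} {ρ ρ' : ℝ} (h : HasGrowth u ρ)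
    (hρ : 0 ≤ ρ) (hle : ρ ≤ ρ') : HasGrowth u ρ' := by
  obtain ⟨C, hC, hu⟩ := h
  exact ⟨C, hC, fun n => (hu n).trans
    (mul_le_mul_of_nonneg_left (pow_le_pow_left₀ hρ hle n) hC)⟩

theorem hasGrowth_pow_norm {A : Type*} [NormedRing A] (a : A) : HasGrowth (fun n => a ^ n) ‖a‖ := by
  refine ⟨max ‖(1 : A)‖ 1, by positivity, fun n => ?_⟩
  rcases Nat.eq_zero_or_pos n with rfl | hn
  · simp
  · exact (norm_pow_le' a hn).trans
      (le_mul_of_one_le_left (by positivity) (le_max_right _ _))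

/-- Growth rates of commuting elements add up, by the binomial formula. -/
theorem HasGrowth.add_pow {A : Type*} [NormedRing A] {a b : A} {α β : ℝ}
    (ha : HasGrowth (fun n => a ^ n) α) (hb : HasGrowth (fun n => b ^ n) β)
    (hα : 0 ≤ α) (hab : Commute a b) :
    HasGrowth (fun n => (a + b) ^ n) (α + β) := by
  obtain ⟨C, hC, ha⟩ := ha
  obtain ⟨D, hD, hb⟩ := hb
  refine ⟨C * D, mul_nonneg hC hD, fun n => ?_⟩
  beta_reduce
  rw [hab.add_pow, (Commute.all α β).add_pow, Finset.mul_sum]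
  refine (norm_sum_le _ _).trans (Finset.sum_le_sum fun m _ => ?_)
  rw [← nsmul_eq_mul']
  refine (norm_nsmul_le).trans ?_
  have h1 : ‖a ^ m * b ^ (n - m)‖ ≤ (C * α ^ m) * (D * β ^ (n - m)) :=
    (norm_mul_le _ _).trans (mul_le_mul (ha m) (hb (n - m)) (norm_nonneg _)
      (mul_nonneg hC (pow_nonneg hα m)))
  calc (n.choose m : ℝ) * ‖a ^ m * b ^ (n - m)‖
      ≤ (n.choose m : ℝ) * ((C * α ^ m) * (D * β ^ (n - m))) :=
        mul_le_mul_of_nonneg_left h1 (Nat.cast_nonneg _)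
    _ = C * D * (α ^ m * β ^ (n - m) * (n.choose m : ℝ)) := by ring

/-- A commuting perturbation of growth rate `0` does not enlarge the spectrum. -/
theorem spectrum_add_subset {A : Type*} [NormedRing A] [NormedAlgebra ℂ A] [CompleteSpace A]
    {a q : A} (hq : ∀ ρ : ℝ, 0 < ρ → HasGrowth (fun n => q ^ n) ρ) (haq : Commute a q) :
    spectrum ℂ (a + q) ⊆ spectrum ℂ a := by
  intro z
  contrapose!
  rw [spectrum.notMem_iff, spectrum.notMem_iff]
  rintro ⟨u, hu⟩
  have huq : Commute (u : A) q := by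
    rw [hu]
    exact Commute.sub_left (Algebra.commutes z q) haq
  have hw : Commute (↑u⁻¹ : A) q := huq.units_inv_left
  set w : A := ↑u⁻¹ * q with hwdef
  -- a rate small enough to beat the growth of the powers of `u⁻¹`
  set ρ : ℝ := (2 * (‖(↑u⁻¹ : A)‖ + 1))⁻¹ with hρdef
  have hρ : 0 < ρ := by positivity
  have hlim : Tendsto (fun n => ‖w ^ n‖) atTop (𝓝 0) := by
    obtain ⟨C, hC, hqn⟩ := hq ρ hρ
    obtain ⟨D, hD, hun⟩ := hasGrowth_pow_norm (↑u⁻¹ : A)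
    have hle : ∀ n, ‖w ^ n‖ ≤ D * C * (1 / 2) ^ n := by
      intro n
      rw [hwdef, hw.mul_pow]
      refine (norm_mul_le _ _).trans ((mul_le_mul (hun n) (hqn n) (norm_nonneg _)
        (by positivity)).trans ?_)
      have h3 : ‖(↑u⁻¹ : A)‖ * ρ ≤ 1 / 2 := by
        rw [hρdef, ← div_eq_mul_inv, div_le_div_iff₀ (by positivity) (by norm_num)]
        linarith
      calc D * ‖(↑u⁻¹ : A)‖ ^ n * (C * ρ ^ n) = D * C * (‖(↑u⁻¹ : A)‖ * ρ) ^ n := by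
            rw [mul_pow]; ring
        _ ≤ D * C * (1 / 2) ^ n := by gcongr
    refine squeeze_zero (fun _ => norm_nonneg _) hle ?_
    simpa using (tendsto_pow_atTop_nhds_zero_of_lt_one (r := (1 / 2 : ℝ)) (by norm_num)
      (by norm_num)).const_mul (D * C)
  obtain ⟨n, hn⟩ := (hlim.eventually_lt_const one_pos).exists
  have hunit : IsUnit (1 - w ^ n) := isUnit_one_sub_of_norm_lt_one hn
  have hw1 : IsUnit (1 - w) := by
    have hcomm : Commute (1 - w) (∑ i ∈ Finset.range n, w ^ i) :=
      Commute.sum_right _ _ _ fun i _ =>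
        ((Commute.one_left _).sub_left ((Commute.refl w).pow_right i))
    rw [← mul_neg_geom_sum, hcomm.isUnit_mul_iff] at hunit
    exact hunit.1
  have : algebraMap ℂ A z - (a + q) = u * (1 - w) := by
    rw [mul_sub, mul_one, hwdef, Units.mul_inv_cancel_left, hu]
    abel
  rw [this]
  exact u.isUnit.mul hw1

/-- A commuting perturbation of growth rate `0` does not change the spectrum. -/
theorem spectrum_add_eq {A : Type*} [NormedRing A] [NormedAlgebra ℂ A] [CompleteSpace A]
    {a q : A} (hq : ∀ ρ : ℝ, 0 < ρ → HasGrowth (fun n => q ^ n) ρ) (haq : Commute a q) :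
    spectrum ℂ (a + q) = spectrum ℂ a := by
  refine (spectrum_add_subset hq haq).antisymm ?_
  have hneg : ∀ ρ : ℝ, 0 < ρ → HasGrowth (fun n => (-q) ^ n) ρ := by
    intro ρ hρ
    obtain ⟨C, hC, h⟩ := hq ρ hρ
    refine ⟨C, hC, fun n => le_of_eq_of_le ?_ (h n)⟩
    rcases n.even_or_odd with hn | hn
    · simp [hn.neg_pow]
    · simp [hn.neg_pow]
  have h := spectrum_add_subset hneg (haq.add_left (Commute.refl q)).neg_right
  rwa [add_neg_cancel_right] at h

theorem isGeneralizedNilpotent_iff_hasGrowth {V : Type*} [NormedAddCommGroup V] [NormedSpace ℂ V]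
    (N : V →L[ℂ] V) :
    IsGeneralizedNilpotent N ↔ ∀ ρ : ℝ, 0 < ρ → HasGrowth (fun n => N ^ n) ρ := by
  constructor
  · intro h ρ hρ
    refine HasGrowth.of_eventually hρ ?_
    filter_upwards [h.eventually_lt_const hρ, eventually_gt_atTop 0] with n hn hn0
    have h2 := pow_le_pow_left₀ (Real.rpow_nonneg (norm_nonneg _) _) hn.le n
    rwa [one_div, Real.rpow_inv_natCast_pow (norm_nonneg _) hn0.ne'] at h2
  · intro h
    refine Metric.tendsto_atTop'.2 fun ε hε => ?_
    obtain ⟨C, hC, hN⟩ := h (ε / 2) (half_pos hε)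
    -- `C ≤ 2 ^ n` eventually, so that `C * (ε / 2) ^ n ≤ ε ^ n`
    obtain ⟨m, hm⟩ := pow_unbounded_of_one_lt C (one_lt_two (α := ℝ))
    refine ⟨m, fun n hn => ?_⟩
    have hn0 : n ≠ 0 := by omega
    rw [Real.dist_0_eq_abs, abs_of_nonneg (Real.rpow_nonneg (norm_nonneg _) _), one_div]
    have hlt : ‖N ^ n‖ < ε ^ n := by
      refine (hN n).trans_lt ?_
      calc C * (ε / 2) ^ n < 2 ^ n * (ε / 2) ^ n := by
            refine mul_lt_mul_of_pos_right (hm.trans_le ?_) (by positivity)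
            exact pow_le_pow_right₀ one_le_two hn.le
        _ = ε ^ n := by rw [← mul_pow]; congr 1; ring
    calc ‖N ^ n‖ ^ ((n : ℝ)⁻¹) < (ε ^ n) ^ ((n : ℝ)⁻¹) :=
          Real.rpow_lt_rpow (norm_nonneg _) hlt (by positivity)
      _ = ε := Real.pow_rpow_inv_natCast hε.le hn0

/-! ### Restriction of operators to the range of a projection -/

section Restriction

variable {V : Type*} [NormedAddCommGroup V] [NormedSpace ℂ V]

@[simp]
theorem coe_restrictRange_apply (X P : V →L[ℂ] V) (h : Commute X P)
    (x : LinearMap.range (P : V →ₗ[ℂ] V)) : (restrictRange X P h x : V) = X x := rfl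

theorem restrictRange_pow (X P : V →L[ℂ] V) (h : Commute X P) (n : ℕ) :
    restrictRange X P h ^ n = restrictRange (X ^ n) P (h.pow_left n) := by
  induction n with
  | zero => ext x; simp
  | succ n ih => ext x; simp [pow_succ, ih]

theorem norm_restrictRange_le (X P : V →L[ℂ] V) (h : Commute X P) : ‖restrictRange X P h‖ ≤ ‖X‖ :=
  ContinuousLinearMap.opNorm_le_bound _ (norm_nonneg _) fun x => X.le_opNorm x

theorem completeSpace_range [CompleteSpace V] {P : V →L[ℂ] V} (hP : IsIdempotentElem P) :
    CompleteSpace (LinearMap.range (P : V →ₗ[ℂ] V)) :=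
  (ContinuousLinearMap.IsIdempotentElem.isClosed_range hP).completeSpace_coe

/-- An operator on the range of `P`, viewed as an operator on the whole space by composing it with
`P`. For a projection `P` this is extension by zero to the kernel of `P`. -/
def extendRange (P : V →L[ℂ] V)
    (T : LinearMap.range (P : V →ₗ[ℂ] V) →L[ℂ] LinearMap.range (P : V →ₗ[ℂ] V)) : V →L[ℂ] V :=
  (LinearMap.range (P : V →ₗ[ℂ] V)).subtypeL ∘L T ∘L
    P.codRestrict (LinearMap.range (P : V →ₗ[ℂ] V)) (fun x => ⟨x, rfl⟩)

theorem norm_extendRange_le (P : V →L[ℂ] V)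
    (T : LinearMap.range (P : V →ₗ[ℂ] V) →L[ℂ] LinearMap.range (P : V →ₗ[ℂ] V)) :
    ‖extendRange P T‖ ≤ ‖T‖ * ‖P‖ := by
  refine ContinuousLinearMap.opNorm_le_bound _ (by positivity) fun x => ?_
  rw [mul_assoc]
  refine (T.le_opNorm _).trans (mul_le_mul_of_nonneg_left ?_ (norm_nonneg _))
  exact P.le_opNorm x

theorem extendRange_mul {P : V →L[ℂ] V} (hP : IsIdempotentElem P)
    (T U : LinearMap.range (P : V →ₗ[ℂ] V) →L[ℂ] LinearMap.range (P : V →ₗ[ℂ] V)) :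
    extendRange P (T * U) = extendRange P T * extendRange P U := by
  have hfix : ∀ y : LinearMap.range (P : V →ₗ[ℂ] V), P y = y := by
    rintro ⟨_, z, rfl⟩
    exact DFunLike.congr_fun hP.eq z
  ext x
  have : ∀ y : LinearMap.range (P : V →ₗ[ℂ] V), extendRange P T y = T y := fun y =>
    congrArg (fun y => (T y : V)) (Subtype.ext (hfix y))
  exact (this _).symm

theorem extendRange_restrictRange {P : V →L[ℂ] V} (X : V →L[ℂ] V) (h : Commute X P) :
    extendRange P (restrictRange X P h) = X * P := rfl

theorem extendRange_one (P : V →L[ℂ] V) : extendRange P 1 = P := rfl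

theorem spectrum_restrictRange_sub_smul (X P : V →L[ℂ] V) (h : Commute X P) (η : ℂ)
    (h' : Commute (X - η • (1 : V →L[ℂ] V)) P) {z : ℂ}
    (hz : z ∈ spectrum ℂ (restrictRange (X - η • (1 : V →L[ℂ] V)) P h')) :
    z + η ∈ spectrum ℂ (restrictRange X P h) := by
  rw [spectrum.add_mem_iff]
  convert hz using 2
  ext x
  simp [Algebra.algebraMap_eq_smul_one, sub_eq_neg_add]

variable [CompleteSpace V]

/-- If the restriction of `X` to the range of `P` has its spectrum in a disc around `η`, then
`(X - η) ^ n` grows on that range at most geometrically, with any larger radius. -/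
theorem hasGrowth_of_spectrum_restrictRange_subset {X P : V →L[ℂ] V} (hP : IsIdempotentElem P)
    (h : Commute X P) {η : ℂ} {r ρ : ℝ} (hρ : 0 < ρ) (hr : r < ρ)
    (hs : spectrum ℂ (restrictRange X P h) ⊆ Metric.closedBall η r) :
    HasGrowth (fun n => (X - η • (1 : V →L[ℂ] V)) ^ n * P) ρ := by
  have h' : Commute (X - η • (1 : V →L[ℂ] V)) P := h.sub_left ((Commute.one_left P).smul_left η)
  have := completeSpace_range hP
  obtain ⟨C, hC, hn⟩ := hasGrowth_pow_of_spectrum_subset (r := r) hρ hr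
    (a := restrictRange (X - η • (1 : V →L[ℂ] V)) P h') (fun z hz => by
      simpa using hs (spectrum_restrictRange_sub_smul X P h η h' hz))
  refine ⟨C * ‖P‖, by positivity, fun n => ?_⟩
  have := hn n
  simp only [restrictRange_pow] at this
  change ‖(X - η • (1 : V →L[ℂ] V)) ^ n * P‖ ≤ _
  rw [← extendRange_restrictRange _ (h'.pow_left n)]
  calc _ ≤ _ := norm_extendRange_le _ _
    _ ≤ C * ρ ^ n * ‖P‖ := by gcongr
    _ = _ := by ring

/-- If the restriction of `X` to the range of `P` has its spectrum outside a disc around `η`, then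
`(X - η) ^ n` is invertible on that range, with inverses `R n` that are geometrically small. -/
theorem exists_hasGrowth_inverse {X P : V →L[ℂ] V} (hP : IsIdempotentElem P)
    (h : Commute X P) {η : ℂ} {r ρ : ℝ} (hr : 0 < r) (hρ : r⁻¹ < ρ)
    (hs : ∀ z ∈ spectrum ℂ (restrictRange X P h), r ≤ dist z η) :
    ∃ R : ℕ → V →L[ℂ] V, HasGrowth R ρ ∧
      (∀ n, (X - η • (1 : V →L[ℂ] V)) ^ n * R n = P) ∧
      ∀ n, R n * (X - η • (1 : V →L[ℂ] V)) ^ n = P := by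
  have h' : Commute (X - η • (1 : V →L[ℂ] V)) P := h.sub_left ((Commute.one_left P).smul_left η)
  have := completeSpace_range hP
  set Y := X - η • (1 : V →L[ℂ] V) with hY
  have hdist : ∀ z ∈ spectrum ℂ (restrictRange Y P h'), r ≤ ‖z‖ := fun z hz => by
    simpa using hs _ (spectrum_restrictRange_sub_smul X P h η h' hz)
  have hu : IsUnit (restrictRange Y P h') := by
    rw [← spectrum.zero_notMem_iff ℂ]
    intro h0
    have := hdist 0 h0
    rw [norm_zero] at this
    exact hr.not_ge this
  obtain ⟨u, hu⟩ := hu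
  obtain ⟨C, hC, hn⟩ := hasGrowth_pow_of_spectrum_subset (a := (↑u⁻¹ :
      LinearMap.range (P : V →ₗ[ℂ] V) →L[ℂ] LinearMap.range (P : V →ₗ[ℂ] V)))
      (r := r⁻¹) (ρ := ρ) ((inv_pos.2 hr).trans hρ) hρ (fun z hz => by
        have hz' : z⁻¹ ∈ spectrum ℂ (restrictRange Y P h') := by
          rw [← hu, ← spectrum.inv₀_mem_inv_iff, inv_inv]
          exact hz
        have h1 := hdist _ hz'
        rw [norm_inv] at h1
        rw [mem_closedBall_zero_iff]
        exact le_inv_of_le_inv₀ hr h1)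
  have hpow : ∀ n, (↑(u ^ n) : LinearMap.range (P : V →ₗ[ℂ] V) →L[ℂ] LinearMap.range
      (P : V →ₗ[ℂ] V)) = restrictRange (Y ^ n) P (h'.pow_left n) := fun n => by
    rw [Units.val_pow_eq_pow_val, hu, restrictRange_pow]
  have hPR : ∀ T, P * extendRange P T = extendRange P T := fun T => by
    simpa only [one_mul, extendRange_one] using (extendRange_mul hP 1 T).symm
  have hRP : ∀ T, extendRange P T * P = extendRange P T := fun T => by
    simpa only [mul_one, extendRange_one] using (extendRange_mul hP T 1).symm
  refine ⟨fun n => extendRange P ↑(u ^ n)⁻¹, ⟨C * ‖P‖, by positivity, fun n => ?_⟩,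
    fun n => ?_, fun n => ?_⟩
  · have := hn n
    simp only [← Units.val_pow_eq_pow_val, inv_pow] at this
    calc _ ≤ _ := norm_extendRange_le _ _
      _ ≤ C * ρ ^ n * ‖P‖ := by gcongr
      _ = _ := by ring
  · change Y ^ n * extendRange P _ = P
    rw [← hPR, ← mul_assoc, ← extendRange_restrictRange _ (h'.pow_left n), ← extendRange_mul hP,
      ← hpow, Units.mul_inv, extendRange_one]
  · change extendRange P _ * Y ^ n = P
    rw [← hRP, mul_assoc, ← (h'.pow_left n).eq, ← extendRange_restrictRange _ (h'.pow_left n),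
      ← extendRange_mul hP, ← hpow, Units.inv_mul, extendRange_one]

end Restriction

/-! ### Additivity and boundedness of spectral measures -/

section SpectralMeasure

variable {V : Type*} [NormedAddCommGroup V] [NormedSpace ℂ V] {E : Set ℂ → V →L[ℂ] V}

namespace IsSpectralMeasure

open Classical in
/-- The vector measure `s ↦ E s x`, set to `0` at the sets that are not Borel. -/
noncomputable def vectorMeasure (hE : IsSpectralMeasure E) (x : V) :
    MeasureTheory.VectorMeasure ℂ V where
  measureOf' s := if MeasurableSet s then E s x else 0
  empty' := by simp [hE.empty]
  not_measurable' s hs := if_neg hs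
  m_iUnion' f hf hd := by
    simpa only [hf, MeasurableSet.iUnion hf, if_true] using hE.hasSum_iUnion f hf hd x

theorem vectorMeasure_apply (hE : IsSpectralMeasure E) (x : V) {s : Set ℂ} (hs : MeasurableSet s) :
    hE.vectorMeasure x s = E s x := if_pos hs

theorem isIdempotentElem (hE : IsSpectralMeasure E) {s : Set ℂ} (hs : MeasurableSet s) :
    IsIdempotentElem (E s) := by
  rw [IsIdempotentElem, ← hE.inter s s hs hs, Set.inter_self]

theorem commute (hE : IsSpectralMeasure E) {s t : Set ℂ} (hs : MeasurableSet s)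
    (ht : MeasurableSet t) : Commute (E s) (E t) := by
  rw [Commute, SemiconjBy, ← hE.inter s t hs ht, ← hE.inter t s ht hs, Set.inter_comm]

theorem add_compl (hE : IsSpectralMeasure E) {s : Set ℂ} (hs : MeasurableSet s) :
    E s + E sᶜ = 1 := by
  ext x
  have h := (hE.vectorMeasure x).of_union disjoint_compl_right hs hs.compl
  rw [Set.union_compl_self, hE.vectorMeasure_apply x hs, hE.vectorMeasure_apply x hs.compl,
    hE.vectorMeasure_apply x MeasurableSet.univ, hE.univ] at h
  exact h.symm

theorem biUnion_finset (hE : IsSpectralMeasure E) {ι : Type*} (I : Finset ι) {A : ι → Set ℂ}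
    (hA : ∀ i ∈ I, MeasurableSet (A i)) (hd : (I : Set ι).PairwiseDisjoint A) :
    E (⋃ i ∈ I, A i) = ∑ i ∈ I, E (A i) := by
  ext x
  have h := (hE.vectorMeasure x).of_biUnion_finset hd hA
  rw [hE.vectorMeasure_apply x (I.measurableSet_biUnion hA)] at h
  rw [h, sum_apply]
  exact Finset.sum_congr rfl fun i hi => hE.vectorMeasure_apply x (hA i hi)

theorem sum_parts_inter (hE : IsSpectralMeasure E) {D : Set ℂ} (P : Finpartition D)
    (hP : ∀ s ∈ P.parts, MeasurableSet s) {t : Set ℂ} (ht : MeasurableSet t) (htD : t ⊆ D) :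
    ∑ s ∈ P.parts, E (s ∩ t) = E t := by
  rw [← hE.biUnion_finset P.parts (fun s hs => (hP s hs).inter ht)
    (P.disjoint.mono fun s => Set.inter_subset_left), ← Set.iUnion₂_inter]
  congr 1
  refine Set.inter_eq_right.2 (htD.trans (le_of_eq ?_))
  simpa [Finset.sup_set_eq_biUnion] using P.sup_parts.symm

theorem sum_parts (hE : IsSpectralMeasure E) {D : Set ℂ} (P : Finpartition D)
    (hP : ∀ s ∈ P.parts, MeasurableSet s) (hD : MeasurableSet D) : ∑ s ∈ P.parts, E s = E D := by
  rw [← hE.sum_parts_inter P hP hD subset_rfl]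
  exact Finset.sum_congr rfl fun s hs => by rw [Set.inter_eq_left.2 (P.le hs)]

/-- If `E` is annihilated on the right by `A` on countably many Borel sets, then also on their
union. -/
theorem iUnion_mul_eq_zero (hE : IsSpectralMeasure E) {s : ℕ → Set ℂ}
    (hs : ∀ n, MeasurableSet (s n)) {A : V →L[ℂ] V} (h : ∀ n, E (s n) * A = 0) :
    E (⋃ n, s n) * A = 0 := by
  have hm : ∀ n, MeasurableSet (disjointed s n) := fun n => MeasurableSet.disjointed hs n
  ext x
  have hsum := hE.hasSum_iUnion _ hm (disjoint_disjointed s) (A x)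
  have hz : ∀ n, E (disjointed s n) (A x) = 0 := fun n => by
    have : E (disjointed s n) * A = 0 := by
      rw [← Set.inter_eq_left.2 (disjointed_subset s n), hE.inter _ _ (hm n) (hs n), mul_assoc,
        h n, mul_zero]
    exact DFunLike.congr_fun this x
  simp only [hz, iUnion_disjointed] at hsum
  exact hsum.unique hasSum_zero

/-- If `E` is annihilated on the left by `A` on countably many Borel sets, then also on their
union. -/
theorem mul_iUnion_eq_zero (hE : IsSpectralMeasure E) {s : ℕ → Set ℂ}
    (hs : ∀ n, MeasurableSet (s n)) {A : V →L[ℂ] V} (h : ∀ n, A * E (s n) = 0) :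
    A * E (⋃ n, s n) = 0 := by
  have hm : ∀ n, MeasurableSet (disjointed s n) := fun n => MeasurableSet.disjointed hs n
  ext x
  have hsum := (hE.hasSum_iUnion _ hm (disjoint_disjointed s) x).mapL A
  have hz : ∀ n, A (E (disjointed s n) x) = 0 := fun n => by
    have : A * E (disjointed s n) = 0 := by
      rw [← Set.inter_eq_right.2 (disjointed_subset s n), hE.inter _ _ (hs n) (hm n), ← mul_assoc,
        h n, zero_mul]
    exact DFunLike.congr_fun this x
  simp only [hz, iUnion_disjointed] at hsum
  exact hsum.unique hasSum_zero

end IsSpectralMeasure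

/-- A nonempty subset of the plane on which `r` is positive is covered by countably many of the balls
`ball x (r x)` centred in it. -/
theorem exists_seq_ball_cover {U : Set ℂ} (hne : U.Nonempty) {r : ℂ → ℝ}
    (hr : ∀ x ∈ U, 0 < r x) :
    ∃ x : ℕ → ℂ, (∀ n, x n ∈ U) ∧ U ⊆ ⋃ n, Metric.ball (x n) (r (x n)) := by
  obtain ⟨T, hTU, hTc, hT⟩ := TopologicalSpace.countable_cover_nhdsWithin
    (f := fun x => Metric.ball x (r x)) (s := U)
    fun x hx => mem_nhdsWithin_of_mem_nhds (Metric.ball_mem_nhds x (hr x hx))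
  have hTne : T.Nonempty := by
    obtain ⟨y, hy⟩ := hne
    obtain ⟨x, hx, -⟩ := Set.mem_iUnion₂.1 (hT hy)
    exact ⟨x, hx⟩
  obtain ⟨x, rfl⟩ := hTc.exists_eq_range hTne
  refine ⟨x, fun n => hTU ⟨n, rfl⟩, ?_⟩
  rwa [Set.biUnion_range] at hT

namespace IsSpectralMeasure

/-- By the Lindelöf property, `E U * A = 0` for open `U` is a local statement on `U`. -/
theorem mul_eq_zero_of_local (hE : IsSpectralMeasure E) {U : Set ℂ} (hU : IsOpen U)
    {A : V →L[ℂ] V} (h : ∀ x ∈ U, ∃ r > 0, E (Metric.ball x r) * A = 0) : E U * A = 0 := by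
  rcases U.eq_empty_or_nonempty with rfl | hne
  · rw [hE.empty, zero_mul]
  choose! r hr hrA using h
  obtain ⟨x, hx, hcov⟩ := exists_seq_ball_cover hne hr
  have h0 := hE.iUnion_mul_eq_zero (fun n => Metric.isOpen_ball.measurableSet)
    fun n => hrA (x n) (hx n)
  rw [← Set.inter_eq_left.2 hcov, hE.inter _ _ hU.measurableSet
    (MeasurableSet.iUnion fun n => Metric.isOpen_ball.measurableSet), mul_assoc, h0, mul_zero]

theorem mul_eq_zero_of_local' (hE : IsSpectralMeasure E) {U : Set ℂ} (hU : IsOpen U)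
    {A : V →L[ℂ] V} (h : ∀ x ∈ U, ∃ r > 0, A * E (Metric.ball x r) = 0) : A * E U = 0 := by
  rcases U.eq_empty_or_nonempty with rfl | hne
  · rw [hE.empty, mul_zero]
  choose! r hr hrA using h
  obtain ⟨x, hx, hcov⟩ := exists_seq_ball_cover hne hr
  have h0 := hE.mul_iUnion_eq_zero (fun n => Metric.isOpen_ball.measurableSet)
    fun n => hrA (x n) (hx n)
  rw [← Set.inter_eq_right.2 hcov, hE.inter _ _
    (MeasurableSet.iUnion fun n => Metric.isOpen_ball.measurableSet) hU.measurableSet,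
    ← mul_assoc, h0, zero_mul]

end IsSpectralMeasure

theorem sum_abs_le_of_forall_abs_sum_le {ι : Type*} (I : Finset ι) (a : ι → ℝ) {M : ℝ}
    (h : ∀ J ⊆ I, |∑ i ∈ J, a i| ≤ M) : ∑ i ∈ I, |a i| ≤ 2 * M := by
  rw [← Finset.sum_filter_add_sum_filter_not I (fun i => 0 ≤ a i), two_mul]
  refine add_le_add ?_ ?_
  · rw [Finset.sum_congr rfl fun i hi => abs_of_nonneg (Finset.mem_filter.1 hi).2]
    exact (le_abs_self _).trans (h _ (Finset.filter_subset _ _))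
  · rw [Finset.sum_congr rfl fun i hi => abs_of_neg (not_le.1 (Finset.mem_filter.1 hi).2),
      Finset.sum_neg_distrib]
    exact (neg_le_abs _).trans (h _ (Finset.filter_subset _ _))

theorem sum_norm_le_of_forall_norm_sum_le {ι : Type*} (I : Finset ι) (z : ι → ℂ) {M : ℝ}
    (h : ∀ J ⊆ I, ‖∑ i ∈ J, z i‖ ≤ M) : ∑ i ∈ I, ‖z i‖ ≤ 4 * M := by
  have hre := sum_abs_le_of_forall_abs_sum_le I (fun i => (z i).re) fun J hJ => by
    rw [← Complex.re_sum]
    exact (Complex.abs_re_le_norm _).trans (h J hJ)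
  have him := sum_abs_le_of_forall_abs_sum_le I (fun i => (z i).im) fun J hJ => by
    rw [← Complex.im_sum]
    exact (Complex.abs_im_le_norm _).trans (h J hJ)
  calc ∑ i ∈ I, ‖z i‖ ≤ ∑ i ∈ I, (|(z i).re| + |(z i).im|) :=
        Finset.sum_le_sum fun i _ => Complex.norm_le_abs_re_add_abs_im _
    _ ≤ 4 * M := by rw [Finset.sum_add_distrib]; linarith

/-- The basic estimate for integrals of simple functions: `E` has bounded variation along every
pair of a vector and a functional, so `‖∑ c i • E (A i)‖ ≤ 4 K sup |c|`. -/
theorem IsSpectralMeasure.norm_sum_smul_le (hE : IsSpectralMeasure E) {K : ℝ}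
    (hK : ∀ s, MeasurableSet s → ‖E s‖ ≤ K) {ι : Type*} (I : Finset ι) {A : ι → Set ℂ}
    (hA : ∀ i ∈ I, MeasurableSet (A i)) (hd : (I : Set ι).PairwiseDisjoint A) {c : ι → ℂ} {δ : ℝ}
    (hδ : 0 ≤ δ) (hc : ∀ i ∈ I, (A i).Nonempty → ‖c i‖ ≤ δ) :
    ‖∑ i ∈ I, c i • E (A i)‖ ≤ 4 * K * δ := by
  have hK0 : 0 ≤ K := (norm_nonneg _).trans (hK ∅ MeasurableSet.empty)
  refine ContinuousLinearMap.opNorm_le_bound _ (by positivity) fun x => ?_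
  refine NormedSpace.norm_le_dual_bound ℂ _ (by positivity) fun f => ?_
  have hvar : ∑ i ∈ I, ‖f (E (A i) x)‖ ≤ 4 * (‖f‖ * (K * ‖x‖)) := by
    refine sum_norm_le_of_forall_norm_sum_le I _ fun J hJ => ?_
    have : ∑ i ∈ J, f (E (A i) x) = f (E (⋃ i ∈ J, A i) x) := by
      rw [hE.biUnion_finset J (fun i hi => hA i (hJ hi)) (hd.subset (Finset.coe_subset.2 hJ)),
        sum_apply, map_sum]
    rw [this]
    refine (f.le_opNorm _).trans (mul_le_mul_of_nonneg_left ?_ (norm_nonneg _))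
    refine ((E _).le_opNorm x).trans (mul_le_mul_of_nonneg_right ?_ (norm_nonneg _))
    exact hK _ (J.measurableSet_biUnion fun i hi => hA i (hJ hi))
  have hterm : ∀ i ∈ I, ‖c i * f (E (A i) x)‖ ≤ δ * ‖f (E (A i) x)‖ := by
    intro i hi
    rw [norm_mul]
    rcases (A i).eq_empty_or_nonempty with h0 | h0
    · simp [h0, hE.empty]
    · exact mul_le_mul_of_nonneg_right (hc i hi h0) (norm_nonneg _)
  calc ‖f ((∑ i ∈ I, c i • E (A i)) x)‖ = ‖∑ i ∈ I, c i * f (E (A i) x)‖ := by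
        simp
    _ ≤ ∑ i ∈ I, δ * ‖f (E (A i) x)‖ := (norm_sum_le _ _).trans (Finset.sum_le_sum hterm)
    _ = δ * ∑ i ∈ I, ‖f (E (A i) x)‖ := by rw [Finset.mul_sum]
    _ ≤ δ * (4 * (‖f‖ * (K * ‖x‖))) := mul_le_mul_of_nonneg_left hvar hδ
    _ = 4 * K * δ * ‖x‖ * ‖f‖ := by ring

/-! ### Integration of the identity function against a spectral measure -/

/-- `P` has mesh at most `δ`: each part has diameter at most `δ`. -/
def Finpartition.MeshLE {D : Set ℂ} (P : Finpartition D) (δ : ℝ) : Prop :=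
  ∀ s ∈ P.parts, ∀ x ∈ s, ∀ y ∈ s, dist x y ≤ δ

theorem Finpartition.MeshLE.mono {D : Set ℂ} {P Q : Finpartition D} {δ : ℝ} (hQ : Q.MeshLE δ)
    (h : P ≤ Q) : P.MeshLE δ := by
  intro s hs x hx y hy
  obtain ⟨t, ht, hst⟩ := h hs
  exact hQ t ht x (hst hx) y (hst hy)

theorem exists_finpartition_meshLE {D : Set ℂ} (hD : MeasurableSet D)
    (hb : Bornology.IsBounded D) {δ : ℝ} (hδ : 0 < δ) :
    ∃ P : Finpartition D, (∀ s ∈ P.parts, MeasurableSet s) ∧ P.MeshLE δ := by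
  classical
  have hind : ∀ t : Finset ℂ, ∀ D : Set ℂ, MeasurableSet D →
      D ⊆ ⋃ c ∈ t, Metric.ball c (δ / 2) →
      ∃ P : Finpartition D, (∀ s ∈ P.parts, MeasurableSet s) ∧ P.MeshLE δ := by
    intro t
    induction t using Finset.induction_on with
    | empty =>
      intro D _ hcov
      obtain rfl : D = ∅ := by simpa using hcov
      exact ⟨Finpartition.empty (Set ℂ), by simp, by simp [Finpartition.MeshLE]⟩
    | insert c t _ ih =>
      intro D hD hcov
      have hball : MeasurableSet (Metric.ball c (δ / 2)) := Metric.isOpen_ball.measurableSet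
      obtain ⟨P, hP, hPδ⟩ := ih (D \ Metric.ball c (δ / 2)) (hD.diff hball) (by
        rintro x ⟨hx, hxc⟩
        have := hcov hx
        rw [Finset.set_biUnion_insert] at this
        exact this.resolve_left hxc)
      by_cases hne : D ∩ Metric.ball c (δ / 2) = ∅
      · have hDe : D \ Metric.ball c (δ / 2) = D :=
          sdiff_eq_left.2 (Set.disjoint_iff_inter_eq_empty.2 hne)
        exact ⟨P.copy hDe, hP, hPδ⟩
      · refine ⟨P.extend (b := D ∩ Metric.ball c (δ / 2)) hne
          (Set.disjoint_sdiff_inter) (Set.sdiff_union_inter _ _), ?_, ?_⟩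
        · intro s hs
          rcases Finset.mem_insert.1 hs with rfl | hs
          · exact hD.inter hball
          · exact hP s hs
        · intro s hs x hx y hy
          rcases Finset.mem_insert.1 hs with rfl | hs
          · have h1 := Metric.mem_ball.1 hx.2
            have h2 := Metric.mem_ball.1 hy.2
            linarith [dist_triangle_right x y c]
          · exact hPδ s hs x hx y hy
  obtain ⟨t, htf, ht⟩ := Metric.totallyBounded_iff.1
    (hb.isCompact_closure.totallyBounded.subset subset_closure) (δ / 2) (half_pos hδ)
  exact hind htf.toFinset D hD (by simpa using ht)

theorem Finpartition.measurableSet_inf {D : Set ℂ} [DecidableEq (Set ℂ)] {P Q : Finpartition D}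
    (hP : ∀ s ∈ P.parts, MeasurableSet s) (hQ : ∀ s ∈ Q.parts, MeasurableSet s) :
    ∀ s ∈ (P ⊓ Q).parts, MeasurableSet s := by
  intro s hs
  rw [Finpartition.parts_inf] at hs
  obtain ⟨⟨a, b⟩, hab, rfl⟩ := Finset.mem_image.1 (Finset.mem_of_mem_erase hs)
  obtain ⟨ha, hb⟩ := Finset.mem_product.1 hab
  exact (hP a ha).inter (hQ b hb)

theorem Finpartition.exists_tags {D : Set ℂ} (P : Finpartition D) :
    ∃ ξ : Set ℂ → ℂ, ∀ s ∈ P.parts, ξ s ∈ s := by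
  have h : ∀ s ∈ P.parts, ∃ z : ℂ, z ∈ s := fun s hs =>
    Set.nonempty_iff_ne_empty.2 (P.ne_bot hs)
  choose! ξ hξ using h
  exact ⟨ξ, hξ⟩

theorem HasSpectralIntegral.exists_riemannSum {D : Set ℂ} {f : ℂ → V →L[ℂ] V} {A : V →L[ℂ] V}
    (h : HasSpectralIntegral E D f A) (Q : Finpartition D) (hQ : ∀ s ∈ Q.parts, MeasurableSet s)
    {ε : ℝ} (hε : 0 < ε) :
    ∃ P : Finpartition D, P ≤ Q ∧ (∀ s ∈ P.parts, MeasurableSet s) ∧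
      ∃ ξ : Set ℂ → ℂ, (∀ s ∈ P.parts, ξ s ∈ s) ∧ ‖∑ s ∈ P.parts, f (ξ s) * E s - A‖ < ε := by
  classical
  obtain ⟨P₀, hP₀, h⟩ := h ε hε
  obtain ⟨ξ, hξ⟩ := (P₀ ⊓ Q).exists_tags
  have hm := Finpartition.measurableSet_inf hP₀ hQ
  exact ⟨P₀ ⊓ Q, inf_le_right, hm, ξ, hξ, h _ inf_le_left hm ξ hξ⟩

theorem HasSpectralIntegral.unique {D : Set ℂ} {f : ℂ → V →L[ℂ] V} {A B : V →L[ℂ] V}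
    (hA : HasSpectralIntegral E D f A) (hB : HasSpectralIntegral E D f B) : A = B := by
  refine eq_of_forall_dist_le fun ε hε => ?_
  obtain ⟨P₀, hP₀, h⟩ := hB (ε / 2) (half_pos hε)
  obtain ⟨P, hP, hm, ξ, hξ, hlt⟩ := hA.exists_riemannSum P₀ hP₀ (half_pos hε)
  have h2 := h P hP hm ξ hξ
  rw [← dist_eq_norm] at hlt h2
  linarith [dist_triangle_left A B (∑ s ∈ P.parts, f (ξ s) * E s)]

theorem HasSpectralIntegral.congr {E' : Set ℂ → V →L[ℂ] V} {D : Set ℂ} {f : ℂ → V →L[ℂ] V}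
    {A : V →L[ℂ] V} (h : HasSpectralIntegral E D f A)
    (hEE' : ∀ s, MeasurableSet s → E s = E' s) : HasSpectralIntegral E' D f A := by
  intro ε hε
  obtain ⟨P₀, hP₀, h⟩ := h ε hε
  refine ⟨P₀, hP₀, fun P hP hm ξ hξ => ?_⟩
  have hsum : ∑ s ∈ P.parts, f (ξ s) * E' s = ∑ s ∈ P.parts, f (ξ s) * E s :=
    Finset.sum_congr rfl fun s hs => by rw [hEE' s (hm s hs)]
  rw [hsum]
  exact h P hP hm ξ hξ

/-- Operators commuting with `E` commute with scalar integrals against `E`. -/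
theorem HasSpectralIntegral.commute {D : Set ℂ} {S : V →L[ℂ] V}
    (h : HasSpectralIntegral E D (fun z => z • (1 : V →L[ℂ] V)) S) {A : V →L[ℂ] V}
    (hA : ∀ s, MeasurableSet s → Commute A (E s)) : Commute A S := by
  have hcl : IsClosed {T : V →L[ℂ] V | A * T = T * A} :=
    isClosed_eq (continuous_const_mul A) (continuous_mul_const A)
  refine hcl.closure_subset (Metric.mem_closure_iff.2 fun ε hε => ?_)
  obtain ⟨P₀, hP₀, -⟩ := h ε hε
  obtain ⟨P, -, hm, ξ, -, hlt⟩ := h.exists_riemannSum P₀ hP₀ hε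
  refine ⟨_, Commute.sum_right P.parts _ A fun s hs => ?_, by rwa [dist_comm, dist_eq_norm]⟩
  rw [smul_one_mul]
  exact (hA s (hm s hs)).smul_right _

namespace IsSpectralMeasure

/-- Riemann sums over two fine partitions are close. -/
theorem norm_riemannSum_sub_le (hE : IsSpectralMeasure E) {K : ℝ}
    (hK : ∀ s, MeasurableSet s → ‖E s‖ ≤ K) {D : Set ℂ} {P Q : Finpartition D}
    (hP : ∀ s ∈ P.parts, MeasurableSet s) (hQ : ∀ s ∈ Q.parts, MeasurableSet s) {δ δ' : ℝ}
    (hδ : 0 ≤ δ) (hδ' : 0 ≤ δ') (hPδ : P.MeshLE δ) (hQδ : Q.MeshLE δ') {ξ η : Set ℂ → ℂ}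
    (hξ : ∀ s ∈ P.parts, ξ s ∈ s) (hη : ∀ s ∈ Q.parts, η s ∈ s) :
    ‖∑ s ∈ P.parts, ξ s • E s - ∑ t ∈ Q.parts, η t • E t‖ ≤ 4 * K * (δ + δ') := by
  have h1 : ∑ s ∈ P.parts, ξ s • E s = ∑ p ∈ P.parts ×ˢ Q.parts, ξ p.1 • E (p.1 ∩ p.2) := by
    rw [Finset.sum_product]
    refine Finset.sum_congr rfl fun s hs => ?_
    simp only [← Finset.smul_sum, Set.inter_comm s]
    rw [hE.sum_parts_inter Q hQ (hP s hs) (P.le hs)]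
  have h2 : ∑ t ∈ Q.parts, η t • E t = ∑ p ∈ P.parts ×ˢ Q.parts, η p.2 • E (p.1 ∩ p.2) := by
    rw [Finset.sum_product_right]
    refine Finset.sum_congr rfl fun t ht => ?_
    simp only [← Finset.smul_sum]
    rw [hE.sum_parts_inter P hP (hQ t ht) (Q.le ht)]
  rw [h1, h2, ← Finset.sum_sub_distrib]
  simp only [← sub_smul]
  refine hE.norm_sum_smul_le hK _ (fun p hp => ?_) ?_ (add_nonneg hδ hδ') ?_
  · obtain ⟨hp1, hp2⟩ := Finset.mem_product.1 hp
    exact (hP _ hp1).inter (hQ _ hp2)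
  · rintro ⟨a, b⟩ hab ⟨c, d⟩ hcd hne
    simp only [Finset.coe_product, Set.mem_prod, Finset.mem_coe] at hab hcd
    rcases eq_or_ne a c with rfl | hac
    · have hbd : b ≠ d := fun h => hne (by rw [h])
      exact (Q.disjoint hab.2 hcd.2 hbd).mono Set.inter_subset_right Set.inter_subset_right
    · exact (P.disjoint hab.1 hcd.1 hac).mono Set.inter_subset_left Set.inter_subset_left
  · rintro ⟨s, t⟩ hst ⟨z, hzs, hzt⟩
    obtain ⟨hs, ht⟩ := Finset.mem_product.1 hst
    rw [← dist_eq_norm]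
    exact (dist_triangle _ z _).trans
      (add_le_add (hPδ s hs _ (hξ s hs) z hzs) (hQδ t ht z hzt _ (hη t ht)))

/-- `∫ λ dE(λ)` exists over bounded Borel sets. -/
theorem exists_hasSpectralIntegral [CompleteSpace V] (hE : IsSpectralMeasure E) {D : Set ℂ}
    (hD : MeasurableSet D) (hb : Bornology.IsBounded D) :
    ∃ S, HasSpectralIntegral E D (fun z => z • (1 : V →L[ℂ] V)) S := by
  obtain ⟨K, hK⟩ := hE.bounded
  have hK0 : 0 ≤ K := (norm_nonneg _).trans (hK ∅ MeasurableSet.empty)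
  choose P hP hPδ using fun n : ℕ =>
    exists_finpartition_meshLE hD hb (Nat.one_div_pos_of_nat (α := ℝ) (n := n))
  choose ξ hξ using fun n => (P n).exists_tags
  set T : ℕ → V →L[ℂ] V := fun n => ∑ s ∈ (P n).parts, ξ n s • E s with hT
  have hlim : Tendsto (fun n : ℕ => 1 / ((n : ℝ) + 1)) atTop (𝓝 0) :=
    tendsto_one_div_add_atTop_nhds_zero_nat
  have hcauchy : CauchySeq T := by
    refine cauchySeq_of_le_tendsto_0 (fun n : ℕ => 4 * K * (1 / ((n : ℝ) + 1) + 1 / ((n : ℝ) + 1)))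
      (fun n m k hkn hkm => ?_) (by simpa using (hlim.add hlim).const_mul (4 * K))
    rw [dist_eq_norm]
    refine (hE.norm_riemannSum_sub_le hK (hP n) (hP m) Nat.one_div_pos_of_nat.le
      Nat.one_div_pos_of_nat.le (hPδ n) (hPδ m) (hξ n) (hξ m)).trans ?_
    have h1 := Nat.one_div_le_one_div (α := ℝ) hkn
    have h2 := Nat.one_div_le_one_div (α := ℝ) hkm
    gcongr
  obtain ⟨S, hS⟩ := cauchySeq_tendsto_of_complete hcauchy
  refine ⟨S, fun ε hε => ?_⟩
  set δ : ℝ := ε / (4 * K + 1) with hδ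
  have hδ0 : 0 < δ := by positivity
  obtain ⟨P₀, hP₀, hP₀δ⟩ := exists_finpartition_meshLE hD hb hδ0
  refine ⟨P₀, hP₀, fun Q hQ hm η hη => ?_⟩
  simp only [smul_one_mul]
  have hle : ‖∑ s ∈ Q.parts, η s • E s - S‖ ≤ 4 * K * (δ + 0) := by
    refine le_of_tendsto_of_tendsto (tendsto_const_nhds.sub hS).norm
      ((tendsto_const_nhds.add hlim).const_mul (4 * K)) (Eventually.of_forall fun n => ?_)
    exact hE.norm_riemannSum_sub_le hK hm (hP n) hδ0.le Nat.one_div_pos_of_nat.le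
      (hP₀δ.mono hQ) (hPδ n) hη (hξ n)
  refine hle.trans_lt ?_
  rw [add_zero, hδ, ← mul_div_assoc, div_lt_iff₀ (by positivity)]
  linarith

/-- On the range of `E s` for a small set `s`, the operator `∫ λ dE(λ)` is close to a scalar. -/
theorem norm_integral_sub_smul_mul_le (hE : IsSpectralMeasure E) {K : ℝ}
    (hK : ∀ s, MeasurableSet s → ‖E s‖ ≤ K) {D : Set ℂ} (hD : MeasurableSet D)
    (hb : Bornology.IsBounded D) {S : V →L[ℂ] V}
    (hS : HasSpectralIntegral E D (fun z => z • (1 : V →L[ℂ] V)) S) {s : Set ℂ}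
    (hs : MeasurableSet s) (hsD : s ⊆ D) {η : ℂ} {r : ℝ} (hr : 0 ≤ r)
    (hsr : s ⊆ Metric.closedBall η r) :
    ‖(S - η • (1 : V →L[ℂ] V)) * E s‖ ≤ 4 * K * r := by
  have hlim : Tendsto (fun δ : ℝ => 4 * K * (δ + r) + δ * ‖E s‖) (𝓝[>] 0) (𝓝 (4 * K * r)) := by
    have : Continuous fun δ : ℝ => 4 * K * (δ + r) + δ * ‖E s‖ := by fun_prop
    simpa using (this.tendsto 0).mono_left nhdsWithin_le_nhds
  refine ge_of_tendsto hlim (eventually_mem_nhdsWithin.mono fun δ hδ => ?_)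
  obtain ⟨Q, hQ, hQδ⟩ := exists_finpartition_meshLE hD hb hδ
  obtain ⟨P, hPQ, hP, ξ, hξ, hlt⟩ := hS.exists_riemannSum Q hQ hδ
  have hPδ := hQδ.mono hPQ
  simp only [smul_one_mul] at hlt
  set T := ∑ t ∈ P.parts, ξ t • E t with hT
  have h1 : (T - η • (1 : V →L[ℂ] V)) * E s = ∑ t ∈ P.parts, (ξ t - η) • E (t ∩ s) := by
    simp only [sub_smul, Finset.sum_sub_distrib, ← Finset.smul_sum]
    rw [hE.sum_parts_inter P hP hs hsD, sub_mul, smul_one_mul, hT, Finset.sum_mul]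
    congr 1
    exact Finset.sum_congr rfl fun t ht => by rw [smul_mul_assoc, hE.inter t s (hP t ht) hs]
  have h2 : ‖(T - η • (1 : V →L[ℂ] V)) * E s‖ ≤ 4 * K * (δ + r) := by
    rw [h1]
    refine hE.norm_sum_smul_le hK _ (fun t ht => (hP t ht).inter hs)
      (P.disjoint.mono fun t => Set.inter_subset_left) (add_nonneg (le_of_lt hδ) hr) ?_
    rintro t ht ⟨z, hzt, hzs⟩
    rw [← dist_eq_norm]
    exact (dist_triangle _ z _).trans (add_le_add (hPδ t ht _ (hξ t ht) z hzt) (hsr hzs))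
  have h3 : (S - η • (1 : V →L[ℂ] V)) * E s
      = (T - η • (1 : V →L[ℂ] V)) * E s - (T - S) * E s := by
    rw [← sub_mul]; congr 1; abel
  rw [h3]
  refine (norm_sub_le _ _).trans (add_le_add h2 ?_)
  exact (norm_mul_le _ _).trans (mul_le_mul_of_nonneg_right hlt.le (norm_nonneg _))

end IsSpectralMeasure

end SpectralMeasure

/-! ### Resolutions of the identity -/

section Resolution

variable {V : Type*} [NormedAddCommGroup V] [NormedSpace ℂ V]

theorem spectrum_restrictRange_subset (X P : V →L[ℂ] V) (h : Commute X P) :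
    spectrum ℂ (restrictRange X P h) ⊆ spectrum ℂ X := by
  intro z
  contrapose!
  rw [spectrum.notMem_iff, spectrum.notMem_iff]
  rintro ⟨u, hu⟩
  have hcomm : Commute (u : V →L[ℂ] V) P := by
    rw [hu]
    exact Commute.sub_left (Algebra.commutes z P) h
  have hval : algebraMap ℂ _ z - restrictRange X P h = restrictRange u P hcomm := by
    ext x
    simp [hu, Algebra.algebraMap_eq_smul_one]
  rw [hval]
  refine ⟨⟨_, restrictRange _ P hcomm.units_inv_left, ?_, ?_⟩, rfl⟩
  · ext x
    exact DFunLike.congr_fun u.mul_inv (x : V)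
  · ext x
    exact DFunLike.congr_fun u.inv_mul (x : V)

/-- A commuting quasinilpotent perturbation does not change the spectrum of a restriction. -/
theorem spectrum_restrictRange_add [CompleteSpace V] {X N P : V →L[ℂ] V} (hP : IsIdempotentElem P)
    (hX : Commute X P) (hN : Commute N P) (hXN : Commute X N) (hnil : IsGeneralizedNilpotent N)
    (h : Commute (X + N) P) :
    spectrum ℂ (restrictRange (X + N) P h) = spectrum ℂ (restrictRange X P hX) := by
  have := completeSpace_range hP
  have hadd : restrictRange (X + N) P h = restrictRange X P hX + restrictRange N P hN := rfl
  rw [hadd]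
  refine spectrum_add_eq (a := restrictRange X P hX) (q := restrictRange N P hN)
    (fun ρ hρ => ?_) ?_
  · obtain ⟨C, hC, hn⟩ := (isGeneralizedNilpotent_iff_hasGrowth N).1 hnil ρ hρ
    refine ⟨C, hC, fun n => ?_⟩
    simp only [restrictRange_pow]
    exact (norm_restrictRange_le _ _ _).trans (hn n)
  · ext x
    exact DFunLike.congr_fun hXN.eq (x : V)

namespace IsResolutionOfIdentity

variable [CompleteSpace V] {X : V →L[ℂ] V} {E E' : Set ℂ → V →L[ℂ] V}

/-- A resolution of the identity is also one for every commuting quasinilpotent perturbation. -/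
theorem add_isGeneralizedNilpotent (hE : IsResolutionOfIdentity X E) {N : V →L[ℂ] V}
    (hN : ∀ s, MeasurableSet s → Commute N (E s)) (hXN : Commute X N)
    (hnil : IsGeneralizedNilpotent N) : IsResolutionOfIdentity (X + N) E where
  isSpectralMeasure := hE.isSpectralMeasure
  commute s hs := (hE.commute s hs).add_left (hN s hs)
  spectrum_subset s hs := by
    rw [spectrum_restrictRange_add (hE.isSpectralMeasure.isIdempotentElem hs) (hE.commute s hs)
      (hN s hs) hXN hnil]
    exact hE.spectrum_subset s hs

/-- A resolution of the identity is concentrated on the spectrum: on a small disc off the spectrum,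
the restriction of `X` has empty spectrum, so the range of the projection is trivial. -/
theorem apply_spectrum (hE : IsResolutionOfIdentity X E) : E (spectrum ℂ X) = 1 := by
  have hS := hE.isSpectralMeasure
  have hcl : IsClosed (spectrum ℂ X) := spectrum.isClosed X
  have h0 : E (spectrum ℂ X)ᶜ * 1 = 0 := by
    refine hS.mul_eq_zero_of_local hcl.isOpen_compl fun x hx => ?_
    obtain ⟨r, hr, hrU⟩ := Metric.nhds_basis_closedBall.mem_iff.1 (hcl.isOpen_compl.mem_nhds hx)
    have hm : MeasurableSet (Metric.ball x r) := Metric.isOpen_ball.measurableSet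
    refine ⟨r, hr, ?_⟩
    have := completeSpace_range (hS.isIdempotentElem hm)
    rcases subsingleton_or_nontrivial (LinearMap.range (E (Metric.ball x r) : V →ₗ[ℂ] V))
      with hsub | hnt
    · ext y
      exact congrArg Subtype.val (hsub.elim
        (⟨E (Metric.ball x r) y, y, rfl⟩ : LinearMap.range (E (Metric.ball x r) : V →ₗ[ℂ] V)) 0)
    · obtain ⟨z, hz⟩ := spectrum.nonempty (restrictRange X _ (hE.commute _ hm))
      exact absurd (spectrum_restrictRange_subset _ _ _ hz)
        (hrU (Metric.closure_ball_subset_closedBall (hE.spectrum_subset _ hm hz)))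
  have h1 := hS.add_compl hcl.measurableSet
  rwa [← mul_one (E (spectrum ℂ X)ᶜ), h0, add_zero] at h1

/-- The orthogonality behind the uniqueness statements. Let `A` commute with `X`. If `E` and `E'` are
resolutions of the identity for `X`, `s` lies in a disc around `η` and `t` outside a larger disc,
then `(X - η) ^ n` is small on the range of `E s` compared to the range of `E' t`, and therefore
`E s * A * E' t` and `E' t * A * E s` vanish. -/
theorem mul_mul_eq_zero (hE : IsResolutionOfIdentity X E) (hE' : IsResolutionOfIdentity X E')
    {A : V →L[ℂ] V} (hA : Commute X A) {s t : Set ℂ} (hs : MeasurableSet s) (ht : MeasurableSet t)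
    {η : ℂ} {r R : ℝ} (hr : 0 < r) (hrR : r < R) (hsr : s ⊆ Metric.closedBall η r)
    (htR : ∀ z ∈ t, R ≤ dist z η) : E s * A * E' t = 0 ∧ E' t * A * E s = 0 := by
  obtain ⟨ρ, hρ, hρR⟩ := exists_between hrR
  have hρ0 : 0 < ρ := hr.trans hρ
  have hR0 : 0 < R := hρ0.trans hρR
  -- the rates `ρ` on the disc and `σ` of the inverses off the larger disc satisfy `ρ * σ < 1`
  obtain ⟨σ, hσ, hσρ⟩ := exists_between (inv_strictAnti₀ hρ0 hρR)
  have hσ0 : 0 < σ := (inv_pos.2 hR0).trans hσ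
  have hq : ρ * σ < 1 := by
    rw [← mul_inv_cancel₀ hρ0.ne']
    exact mul_lt_mul_of_pos_left hσρ hρ0
  obtain ⟨C, hC, hgrow⟩ := hasGrowth_of_spectrum_restrictRange_subset
    (hE.isSpectralMeasure.isIdempotentElem hs) (hE.commute s hs) hρ0 hρ
    ((hE.spectrum_subset s hs).trans (Metric.isClosed_closedBall.closure_subset_iff.2 hsr))
  have hcl : IsClosed {z : ℂ | R ≤ dist z η} :=
    isClosed_le continuous_const (continuous_id.dist continuous_const)
  obtain ⟨T, ⟨D, hD, hT⟩, hYT, hTY⟩ := exists_hasGrowth_inverse (η := η)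
    (hE'.isSpectralMeasure.isIdempotentElem ht) (hE'.commute t ht) hR0 hσ
    (fun z hz => hcl.closure_subset_iff.2 htR (hE'.spectrum_subset t ht hz))
  set Y := X - η • (1 : V →L[ℂ] V) with hY
  have hYA : ∀ n, Commute (Y ^ n) A := fun n =>
    (hA.sub_left ((Commute.one_left A).smul_left η)).pow_left n
  have hYE : ∀ n, Commute (Y ^ n) (E s) := fun n =>
    ((hE.commute s hs).sub_left ((Commute.one_left (E s)).smul_left η)).pow_left n
  have hlim : Tendsto (fun n => C * ‖A‖ * D * (ρ * σ) ^ n) atTop (𝓝 0) := by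
    simpa using (tendsto_pow_atTop_nhds_zero_of_lt_one (by positivity) hq).const_mul (C * ‖A‖ * D)
  constructor
  · refine norm_le_zero_iff.1 (ge_of_tendsto' hlim fun n => ?_)
    have heq : E s * A * E' t = (Y ^ n * E s) * A * T n := by
      rw [← hYT n, (hYE n).eq, mul_assoc, mul_assoc, mul_assoc, ← mul_assoc A, ← (hYA n).eq,
        mul_assoc]
    calc ‖E s * A * E' t‖ ≤ ‖Y ^ n * E s‖ * ‖A‖ * ‖T n‖ := by
          rw [heq]
          exact (norm_mul_le _ _).trans
            (mul_le_mul_of_nonneg_right (norm_mul_le _ _) (norm_nonneg _))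
      _ ≤ (C * ρ ^ n) * ‖A‖ * (D * σ ^ n) := by
          have h1 := hgrow n
          have h2 := hT n
          gcongr
      _ = C * ‖A‖ * D * (ρ * σ) ^ n := by rw [mul_pow]; ring
  · refine norm_le_zero_iff.1 (ge_of_tendsto' hlim fun n => ?_)
    have heq : E' t * A * E s = T n * A * (Y ^ n * E s) := by
      rw [← hTY n, mul_assoc (T n), (hYA n).eq, mul_assoc, mul_assoc, mul_assoc]
    calc ‖E' t * A * E s‖ ≤ ‖T n‖ * ‖A‖ * ‖Y ^ n * E s‖ := by
          rw [heq]
          exact (norm_mul_le _ _).trans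
            (mul_le_mul_of_nonneg_right (norm_mul_le _ _) (norm_nonneg _))
      _ ≤ (D * σ ^ n) * ‖A‖ * (C * ρ ^ n) := by
          have h1 := hgrow n
          have h2 := hT n
          gcongr
      _ = C * ‖A‖ * D * (ρ * σ) ^ n := by rw [mul_pow]; ring

theorem mul_mul_compl_eq_zero (hE : IsResolutionOfIdentity X E)
    (hE' : IsResolutionOfIdentity X E') {A : V →L[ℂ] V} (hA : Commute X A) {t : Set ℂ}
    (ht : IsClosed t) : E tᶜ * A * E' t = 0 ∧ E' t * A * E tᶜ = 0 := by
  have hball : ∀ x ∈ tᶜ, ∃ r > 0,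
      E (Metric.ball x r) * A * E' t = 0 ∧ E' t * A * E (Metric.ball x r) = 0 := by
    intro x hx
    obtain ⟨R, hR, hRt⟩ := Metric.isOpen_iff.1 ht.isOpen_compl x hx
    refine ⟨R / 2, half_pos hR, hE.mul_mul_eq_zero hE' hA Metric.isOpen_ball.measurableSet
      ht.measurableSet (half_pos hR) (half_lt_self hR) Metric.ball_subset_closedBall fun z hz => ?_⟩
    by_contra! hlt
    exact hRt (Metric.mem_ball.2 hlt) hz
  constructor
  · rw [mul_assoc]
    refine hE.isSpectralMeasure.mul_eq_zero_of_local ht.isOpen_compl fun x hx => ?_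
    obtain ⟨r, hr, h, -⟩ := hball x hx
    exact ⟨r, hr, by rwa [← mul_assoc]⟩
  · refine hE.isSpectralMeasure.mul_eq_zero_of_local' ht.isOpen_compl fun x hx => ?_
    obtain ⟨r, hr, -, h⟩ := hball x hx
    exact ⟨r, hr, h⟩

/-- An operator commuting with `X` intertwines any two resolutions of the identity of `X`. With
`E = E'` this is Dunford's commutativity theorem; with `A = 1` it is the uniqueness of the
resolution of the identity. -/
theorem mul_eq_mul_of_commute (hE : IsResolutionOfIdentity X E) (hE' : IsResolutionOfIdentity X E')
    {A : V →L[ℂ] V} (hA : Commute X A) {t : Set ℂ} (ht : MeasurableSet t) :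
    E t * A = A * E' t := by
  have hS := hE.isSpectralMeasure
  have hS' := hE'.isSpectralMeasure
  induction t, ht using MeasurableSpace.induction_on_inter
    (borel_eq_generateFrom_isClosed (α := ℂ) ▸ BorelSpace.measurable_eq) isPiSystem_isClosed with
  | empty => rw [hS.empty, hS'.empty, zero_mul, mul_zero]
  | basic t ht =>
    have ht : IsClosed t := ht
    -- both sides equal `E t * A * E' t`
    have h1 := (hE.mul_mul_compl_eq_zero hE' hA ht).1
    have h2 := (hE'.mul_mul_compl_eq_zero hE hA ht).2
    calc E t * A = E t * A * (E' t + E' tᶜ) := by rw [hS'.add_compl ht.measurableSet, mul_one]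
      _ = E t * A * E' t + E tᶜ * A * E' t := by rw [mul_add, h2, h1]
      _ = (E t + E tᶜ) * (A * E' t) := by rw [add_mul, mul_assoc, mul_assoc]
      _ = A * E' t := by rw [hS.add_compl ht.measurableSet, one_mul]
  | compl t ht ih =>
    rw [eq_sub_iff_add_eq'.2 (hS.add_compl ht), eq_sub_iff_add_eq'.2 (hS'.add_compl ht), sub_mul,
      mul_sub, ih, one_mul, mul_one]
  | iUnion f hd hm ih =>
    ext x
    have h1 := hS.hasSum_iUnion f hm hd (A x)
    have h2 := (hS'.hasSum_iUnion f hm hd x).mapL A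
    have h3 : ∀ n, E (f n) (A x) = A (E' (f n) x) := fun n => DFunLike.congr_fun (ih n) x
    simp only [h3] at h1
    exact h1.unique h2

/-! ### The canonical decomposition -/

/-- The integral of `λ` against `E` differs from `X` by a quasinilpotent operator `N`: on the range
of `E s` for a set `s` of diameter at most `ε`, both `X - ξ` and `S - ξ` have growth rate
`O(ε)`, and the identity is a finite sum of such projections. -/
theorem isGeneralizedNilpotent_sub (hE : IsResolutionOfIdentity X E) {S : V →L[ℂ] V}
    (hS : HasSpectralIntegral E (spectrum ℂ X) (fun z => z • (1 : V →L[ℂ] V)) S) :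
    IsGeneralizedNilpotent (X - S) := by
  have hM := hE.isSpectralMeasure
  have hD : MeasurableSet (spectrum ℂ X) := (spectrum.isClosed X).measurableSet
  have hb : Bornology.IsBounded (spectrum ℂ X) := spectrum.isBounded X
  have hXS : Commute X S := hS.commute hE.commute
  have hES : ∀ s, MeasurableSet s → Commute S (E s) := fun s hs =>
    (hS.commute fun t ht => hM.commute hs ht).symm
  obtain ⟨K, hK⟩ := hM.bounded
  have hK0 : 0 ≤ K := (norm_nonneg _).trans (hK ∅ MeasurableSet.empty)
  rw [isGeneralizedNilpotent_iff_hasGrowth]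
  intro ρ hρ
  -- `X - ξ` will contribute the rate `2 * ε`, and `S - ξ` the rate `4 * K * ε`
  set ε : ℝ := ρ / (2 + 4 * K) with hε
  have hε0 : 0 < ε := by positivity
  obtain ⟨P, hP, hPε⟩ := exists_finpartition_meshLE hD hb hε0
  obtain ⟨ξ, hξ⟩ := P.exists_tags
  have hpart : ∀ s ∈ P.parts, HasGrowth (fun n => (X - S) ^ n * E s) ρ := by
    intro s hs
    have hsm := hP s hs
    have hid := hM.isIdempotentElem hsm
    have hball : s ⊆ Metric.closedBall (ξ s) ε := fun z hz => hPε s hs z hz _ (hξ s hs)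
    have hXE : Commute (X - ξ s • (1 : V →L[ℂ] V)) (E s) :=
      (hE.commute s hsm).sub_left ((Commute.one_left _).smul_left _)
    have hSE : Commute (S - ξ s • (1 : V →L[ℂ] V)) (E s) :=
      (hES s hsm).sub_left ((Commute.one_left _).smul_left _)
    have hNE : Commute (X - S) (E s) := (hE.commute s hsm).sub_left (hES s hsm)
    have hpow : ∀ {T : V →L[ℂ] V}, Commute T (E s) → ∀ n, n ≠ 0 → (T * E s) ^ n = T ^ n * E s :=
      fun hT n hn => by rw [hT.mul_pow, hid.pow_eq hn]
    have ha : HasGrowth (fun n => ((X - ξ s • (1 : V →L[ℂ] V)) * E s) ^ n) (2 * ε) := by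
      obtain ⟨C, hC, h⟩ := hasGrowth_of_spectrum_restrictRange_subset hid (hE.commute s hsm)
        (ρ := 2 * ε) (by positivity) (by linarith)
        ((hE.spectrum_subset s hsm).trans (Metric.isClosed_closedBall.closure_subset_iff.2 hball))
      refine ⟨max C ‖(1 : V →L[ℂ] V)‖, by positivity, fun n => ?_⟩
      rcases eq_or_ne n 0 with rfl | hn
      · simp
      · beta_reduce
        rw [hpow hXE n hn]
        exact (h n).trans (mul_le_mul_of_nonneg_right (le_max_left _ _) (by positivity))
    have hb' : HasGrowth (fun n => (-((S - ξ s • (1 : V →L[ℂ] V)) * E s)) ^ n) (4 * K * ε) := by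
      refine (hasGrowth_pow_norm _).mono (norm_nonneg _) ?_
      rw [norm_neg]
      exact hM.norm_integral_sub_smul_mul_le hK hD hb hS hsm (P.le hs) hε0.le hball
    have hcomm : Commute ((X - ξ s • (1 : V →L[ℂ] V)) * E s)
        (-((S - ξ s • (1 : V →L[ℂ] V)) * E s)) := by
      refine Commute.neg_right ?_
      have h1 : Commute (X - ξ s • (1 : V →L[ℂ] V)) (S - ξ s • (1 : V →L[ℂ] V)) :=
        (hXS.sub_right ((Commute.one_right _).smul_right _)).sub_left
          ((Commute.one_left _).smul_left _)
      exact (h1.mul_right hXE).mul_left (hSE.symm.mul_right (Commute.refl _))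
    obtain ⟨C, hC, h⟩ := ha.add_pow hb' (by positivity) hcomm
    have hsum : (X - ξ s • (1 : V →L[ℂ] V)) * E s + -((S - ξ s • (1 : V →L[ℂ] V)) * E s)
        = (X - S) * E s := by
      rw [← sub_eq_add_neg, ← sub_mul]
      congr 1
      abel
    have hrate : 2 * ε + 4 * K * ε = ρ := by
      rw [hε]
      field_simp
    rw [hsum, hrate] at h
    refine ⟨max C ‖E s‖, by positivity, fun n => ?_⟩
    rcases eq_or_ne n 0 with rfl | hn
    · simp
    · have := h n
      simp only [hpow hNE n hn] at this
      exact this.trans (mul_le_mul_of_nonneg_right (le_max_left _ _) (by positivity))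
  choose! C hC hbound using hpart
  refine ⟨∑ s ∈ P.parts, C s, Finset.sum_nonneg hC, fun n => ?_⟩
  have hone : (X - S) ^ n = ∑ s ∈ P.parts, (X - S) ^ n * E s := by
    rw [← Finset.mul_sum, hM.sum_parts P hP hD, hE.apply_spectrum, mul_one]
  change ‖(X - S) ^ n‖ ≤ _
  rw [hone, Finset.sum_mul]
  exact (norm_sum_le _ _).trans (Finset.sum_le_sum fun s hs => hbound s hs n)

end IsResolutionOfIdentity

theorem IsGeneralizedNilpotent.neg {N : V →L[ℂ] V} (h : IsGeneralizedNilpotent N) :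
    IsGeneralizedNilpotent (-N) := by
  have hnorm : ∀ n : ℕ, ‖(-N) ^ n‖ = ‖N ^ n‖ := fun n => by
    rcases n.even_or_odd with hn | hn
    · rw [hn.neg_pow]
    · rw [hn.neg_pow, norm_neg]
  simpa only [IsGeneralizedNilpotent, hnorm] using h

theorem spectrum_add_isGeneralizedNilpotent [CompleteSpace V] {X N : V →L[ℂ] V}
    (hXN : Commute X N) (h : IsGeneralizedNilpotent N) : spectrum ℂ (X + N) = spectrum ℂ X :=
  spectrum_add_eq ((isGeneralizedNilpotent_iff_hasGrowth N).1 h) hXN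

end Resolution

theorem mainTheorem4 {V : Type*} [NormedAddCommGroup V] [NormedSpace ℂ V] [CompleteSpace V]
    (X : V →L[ℂ] V) (E : Set ℂ → V →L[ℂ] V) (hE : IsResolutionOfIdentity X E) :
    ∃ S N : V →L[ℂ] V,
      HasSpectralIntegral E (spectrum ℂ X) (fun z => z • (1 : V →L[ℂ] V)) S ∧
      HasSpectralIntegral E (spectrum ℂ X) (fun z => X - z • (1 : V →L[ℂ] V)) N ∧
      X = S + N ∧
      IsCanonicalDecomposition X S N ∧
      ∀ S' N' : V →L[ℂ] V, IsCanonicalDecomposition X S' N' → S' = S ∧ N' = N := by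
  have hM := hE.isSpectralMeasure
  have hD : MeasurableSet (spectrum ℂ X) := (spectrum.isClosed X).measurableSet
  obtain ⟨S, hS⟩ := hM.exists_hasSpectralIntegral hD (spectrum.isBounded X)
  have hXS : Commute X S := hS.commute hE.commute
  have hES : ∀ s, MeasurableSet s → Commute S (E s) := fun s hs =>
    (hS.commute fun t ht => hM.commute hs ht).symm
  have hnil := hE.isGeneralizedNilpotent_sub hS
  have hXN : Commute X (X - S) := (Commute.refl X).sub_right hXS
  have hS_eq : X + -(X - S) = S := by abel
  -- `S = X - N` inherits the resolution of the identity and the spectrum of `X`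
  have hSE : IsResolutionOfIdentity S E := by
    rw [← hS_eq]
    exact hE.add_isGeneralizedNilpotent
      (fun s hs => ((hE.commute s hs).sub_left (hES s hs)).neg_left) hXN.neg_right hnil.neg
  have hSspec : spectrum ℂ S = spectrum ℂ X := by
    rw [← spectrum_add_isGeneralizedNilpotent hXN.neg_right hnil.neg, hS_eq]
  refine ⟨S, X - S, hS, ?_, (add_sub_cancel S X).symm, ⟨(add_sub_cancel S X).symm,
    ⟨E, hSE, by rwa [hSspec]⟩, hnil, hXS.symm.sub_right (Commute.refl S)⟩, ?_⟩
  · intro ε hε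
    obtain ⟨P₀, hP₀, h⟩ := hS ε hε
    refine ⟨P₀, hP₀, fun P hP hm ξ hξ => ?_⟩
    have hsum : ∑ s ∈ P.parts, (X - ξ s • (1 : V →L[ℂ] V)) * E s - (X - S)
        = -(∑ s ∈ P.parts, ξ s • (1 : V →L[ℂ] V) * E s - S) := by
      simp only [sub_mul, Finset.sum_sub_distrib, ← Finset.mul_sum]
      rw [hM.sum_parts P hm hD, hE.apply_spectrum, mul_one]
      abel
    rw [hsum, norm_neg]
    exact h P hP hm ξ hξ
  · rintro S' N' ⟨hX, ⟨E', hE', hS'⟩, hN', hcomm⟩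
    -- `N'` commutes with `E'`, so `E'` is a second resolution of the identity for `X`
    have hXE' : IsResolutionOfIdentity X E' := by
      rw [hX]
      exact hE'.add_isGeneralizedNilpotent
        (fun s hs => (hE'.mul_eq_mul_of_commute hE' hcomm hs).symm) hcomm hN'
    have hEE' : ∀ s, MeasurableSet s → E' s = E s := fun s hs => by
      simpa using hXE'.mul_eq_mul_of_commute hE (Commute.one_right X) hs
    have hspec : spectrum ℂ X = spectrum ℂ S' := by
      rw [hX, spectrum_add_isGeneralizedNilpotent hcomm hN']
    have hSS' : S' = S := by
      rw [← hspec] at hS'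
      exact (hS'.congr hEE').unique hS
    refine ⟨hSS', ?_⟩
    rw [hX, hSS', add_sub_cancel_left]
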